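/- Let $n,m\ge 0$ be integers (number of contacts; number of degrees of freedom of the manipulator). Let $J_{n,o}\in\mathbb R^{n\times 3}$, $J_{t,o}\in\mathbb R^{2n\times 3}$, $J_{n,m}\in\mathbb R^{n\times m}$, $J_{t,m}\in\mathbb R^{2n\times m}$ be the normal and tangential contact Jacobians of a planar object and of the manipulator (two tangential rows per contact), and put $J_o=[J_{n,o};J_{t,o}]$, $J_m=[J_{n,m};J_{t,m}]$. Let $\mu\in\mathbb R^{n\times n}$ be diagonal with non-negative entries (the friction coefficients), let $A\in\mathbb R^{3\times 3}$ and $B\in\mathbb R^{m\times m}$ be symmetric positive definite, let $E\in\mathbb R^{2n\times n}$ be the block-diagonal matrix with $n$ diagonal blocks $[1;1]$, and let $v_d\in\mathbb R^m$ be a commanded velocity. For $X\in\mathbb R^{m\times m}$ and $v\in\mathbb R^m$ put $$M(X)=\begin{bmatrix} J_{n,o}AJ_{n,o}^T+J_{n,m}XJ_{n,m}^T & J_{n,o}AJ_{t,o}^T+J_{n,m}XJ_{t,m}^T & 0\\ J_{t,o}AJ_{n,o}^T+J_{t,m}XJ_{n,m}^T & J_{t,o}AJ_{t,o}^T+J_{t,m}XJ_{t,m}^T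 & E\\ \mu & -E^T & 0\end{bmatrix},\qquad w(v)=\begin{bmatrix} J_{n,m}v\\ J_{t,m}v\\ 0\end{bmatrix}.$$ For a square matrix $M$ and a vector $w$ let $\mathrm{SOL}(M,w)=\{z : z\ge 0,\ Mz+w\ge 0,\ z^T(Mz+w)=0\}$ be the solution set of the linear complementarity problem (inequalities entrywise), and let $$\mathcal F_v=\{f\in\mathbb R^{3n} : \exists s\in\mathbb R^n,\ [f;s]\in\mathrm{SOL}(M(0),w(v))\}$$ be the set of contact forces $f=[f_n;f_t]$ of the perfect-velocity-control model with commanded velocity $v$; $\mathcal F_0$ is the set of admissible internal forces. Suppose that $\mathcal F_0=\{0\}$. Then $\mathcal F_{v_d}\neq\emptyset$, and for every sequence of real numbers $c_i\to 0$ (in particular, for positive feedback scalings $c_i\to 0$) and every sequence $z_i=[f_i;s_i]\in\mathrm{SOL}(M(c_iB),w(v_d))$ of solutions of the finite-feedback model, the contact forces converge to $\mathcal F_{v_d}$, that is, $\mathrm{dist}(f_i,\mathcal F_{v_d})\to 0$ in the Euclidean norm. -/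

import Mathlib

open Matrix

/-- The solution set `SOL(M, w)` of the linear complementarity problem:
all `z` with `z ≥ 0`, `M z + w ≥ 0` (entrywise) and `zᵀ (M z + w) = 0`. -/
def lcpSol {ι : Type*} [Fintype ι] (M : Matrix ι ι ℝ) (w : ι → ℝ) : Set (ι → ℝ) :=
  {z | 0 ≤ z ∧ 0 ≤ M *ᵥ z + w ∧ z ⬝ᵥ (M *ᵥ z + w) = 0}

/-- Index set of the contact force `f = [fₙ; fₜ] ∈ ℝⁿ × ℝ²ⁿ` at `n` contacts. The two tangential
entries `(j, 0)` and `(j, 1)` are the two opposing non-negative tangential forces at contact `j`. -/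
abbrev ForceIdx (n : ℕ) : Type := Fin n ⊕ (Fin n × Fin 2)

/-- Index set of the unknown `z = [f; s]`, where `s ∈ ℝⁿ` is the slack variable. -/
abbrev LCPIdx (n : ℕ) : Type := ForceIdx n ⊕ Fin n

/-- The data, at a fixed configuration, of the quasi-static model of a planar object
(velocity in `ℝ³`) touched at `n` contacts by a manipulator with `m` degrees of freedom. -/
structure ContactModel (n m : ℕ) where
  /-- normal Jacobian of the object -/
  JnO : Matrix (Fin n) (Fin 3) ℝ
  /-- tangential Jacobian of the object (two rows for each contact) -/
  JtO : Matrix (Fin n × Fin 2) (Fin 3) ℝ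
  /-- normal Jacobian of the manipulator -/
  JnM : Matrix (Fin n) (Fin m) ℝ
  /-- tangential Jacobian of the manipulator (two rows for each contact) -/
  JtM : Matrix (Fin n × Fin 2) (Fin m) ℝ
  /-- friction coefficients -/
  mu : Fin n → ℝ
  /-- the matrix of the ellipsoidal limit surface model: object velocity = `A` times the net
  contact force on the object (up to a non-negative scalar absorbed in the force) -/
  A : Matrix (Fin 3) (Fin 3) ℝ

/-- The block-diagonal matrix with `n` diagonal blocks `[1; 1]`. -/
def frictionE (n : ℕ) : Matrix (Fin n × Fin 2) (Fin n) ℝ :=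
  Matrix.of fun p j => if p.1 = j then 1 else 0

namespace ContactModel

variable {n m : ℕ} (S : ContactModel n m)

/-- `J_o = [J_{n,o}; J_{t,o}]`. -/
def JO : Matrix (ForceIdx n) (Fin 3) ℝ := Matrix.fromRows S.JnO S.JtO

/-- `J_m = [J_{n,m}; J_{t,m}]`. -/
def JM : Matrix (ForceIdx n) (Fin m) ℝ := Matrix.fromRows S.JnM S.JtM

/-- The LCP matrix of the perfect velocity control model,
`M = [J_o A J_oᵀ, [0; E]; [μ, -Eᵀ], 0]`. -/
def perfectMat : Matrix (LCPIdx n) (LCPIdx n) ℝ :=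
  Matrix.fromBlocks
    (S.JO * S.A * S.JOᵀ)
    (Matrix.fromRows 0 (frictionE n))
    (Matrix.fromCols (Matrix.diagonal S.mu) (-(frictionE n)ᵀ))
    0

/-- The LCP matrix of the finite feedback model, in which the manipulator velocity is
`v_d + X J_mᵀ f`: `M(X) = [J_o A J_oᵀ + J_m X J_mᵀ, [0; E]; [μ, -Eᵀ], 0]`. -/
def finiteMat (X : Matrix (Fin m) (Fin m) ℝ) : Matrix (LCPIdx n) (LCPIdx n) ℝ :=
  Matrix.fromBlocks
    (S.JO * S.A * S.JOᵀ + S.JM * X * S.JMᵀ)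
    (Matrix.fromRows 0 (frictionE n))
    (Matrix.fromCols (Matrix.diagonal S.mu) (-(frictionE n)ᵀ))
    0

/-- The LCP vector `w(v) = [J_m v; 0]` of a commanded manipulator velocity `v`. -/
def lcpVec (v : Fin m → ℝ) : LCPIdx n → ℝ := Sum.elim (S.JM *ᵥ v) 0

/-- The set `𝓕_v` of contact forces of the perfect velocity control model with commanded
velocity `v`; `𝓕_0` is the set of admissible internal forces. -/
def forceSet (v : Fin m → ℝ) : Set (ForceIdx n → ℝ) :=
  {f | ∃ s : Fin n → ℝ, Sum.elim f s ∈ lcpSol S.perfectMat (S.lcpVec v)}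

end ContactModel

/-- The sequence `x` converges to the set `F`: the Euclidean distance from `x i` to `F` tends
to `0` (this fails for `F = ∅`). -/
def ConvergesToSet {ι : Type*} [Fintype ι] (x : ℕ → ι → ℝ) (F : Set (ι → ℝ)) : Prop :=
  ∀ ε : ℝ, 0 < ε → ∀ᶠ i in Filter.atTop, ∃ g ∈ F, ‖WithLp.toLp 2 (x i - g)‖ < ε

/-- A system of inequalities `0 ≤ b p * (t - r p)` in one real unknown `t`, with pairwise distinct
roots and a lower bound, has an even number of endpoints if it has an upper bound, and exactly
one endpoint otherwise. -/
theorem card_filter_endpoints_mod_two {κ : Type*} [Fintype κ] [DecidableEq κ]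
    (b r : κ → ℝ) (hb : ∀ p, b p ≠ 0) (hr : Function.Injective r) (hlow : ∃ p, 0 < b p)
    (W : κ → Prop) [DecidablePred W] (hW : ∀ o, W o ↔ ∀ p, p ≠ o → 0 < b p * (r o - r p)) :
    ((Finset.univ.filter W).card : ZMod 2) = if ∃ p, b p < 0 then 0 else 1 := by
  classical
  obtain ⟨l, hl, hlmax⟩ := Finset.exists_max_image (Finset.univ.filter fun p => 0 < b p) r
    (by obtain ⟨p, hp⟩ := hlow; exact ⟨p, by simpa using hp⟩)
  simp only [Finset.mem_filter, Finset.mem_univ, true_and] at hl hlmax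
  have hWlow : ∀ o, W o → 0 < b o → o = l := by
    intro o ho hbo
    by_contra hne
    have h1 := (hW o).1 ho l (Ne.symm hne)
    have h2 := hlmax o hbo
    nlinarith
  split_ifs with hup
  · obtain ⟨u, hu, humin⟩ := Finset.exists_min_image (Finset.univ.filter fun p => b p < 0) r
      (by obtain ⟨p, hp⟩ := hup; exact ⟨p, by simpa using hp⟩)
    simp only [Finset.mem_filter, Finset.mem_univ, true_and] at hu humin
    have hWup : ∀ o, W o → b o < 0 → o = u := by
      intro o ho hbo
      by_contra hne
      have h1 := (hW o).1 ho u (Ne.symm hne)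
      have h2 := humin o hbo
      nlinarith
    have hlu : l ≠ u := by rintro rfl; linarith
    have hstrict : ∀ p q, r p ≤ r q → p ≠ q → r p < r q := fun p q h hne =>
      lt_of_le_of_ne h fun h' => hne (hr h')
    have hWl : W l ↔ r l < r u := by
      constructor
      · intro h
        have := (hW l).1 h u hlu.symm
        nlinarith
      · intro h
        refine (hW l).2 fun p hp => ?_
        rcases lt_or_gt_of_ne (hb p) with hbp | hbp
        · exact mul_pos_of_neg_of_neg hbp (by linarith [humin p hbp])
        · exact mul_pos hbp (by linarith [hstrict p l (hlmax p hbp) hp])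
    have hWu : W u ↔ r l < r u := by
      constructor
      · intro h
        have := (hW u).1 h l hlu
        nlinarith
      · intro h
        refine (hW u).2 fun p hp => ?_
        rcases lt_or_gt_of_ne (hb p) with hbp | hbp
        · exact mul_pos_of_neg_of_neg hbp (by linarith [hstrict u p (humin p hbp) hp.symm])
        · exact mul_pos hbp (by linarith [hlmax p hbp])
    have hW' : ∀ o, W o ↔ r l < r u ∧ (o = l ∨ o = u) := by
      intro o
      constructor
      · intro ho
        rcases lt_or_gt_of_ne (hb o) with hbo | hbo
        · have := hWup o ho hbo
          subst this
          exact ⟨hWu.1 ho, Or.inr rfl⟩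
        · have := hWlow o ho hbo
          subst this
          exact ⟨hWl.1 ho, Or.inl rfl⟩
      · rintro ⟨h, rfl | rfl⟩
        exacts [hWl.2 h, hWu.2 h]
    by_cases h : r l < r u
    · have : Finset.univ.filter W = {l, u} := by
        ext o
        simp [hW', h]
      rw [this, Finset.card_pair hlu]
      rfl
    · have : Finset.univ.filter W = ∅ := by
        ext o
        simp [hW', h]
      simp [this]
  · push Not at hup
    have hpos : ∀ p, 0 < b p := fun p => lt_of_le_of_ne (hup p) (hb p).symm
    have : Finset.univ.filter W = {l} := by
      ext o
      simp only [Finset.mem_filter, Finset.mem_univ, true_and, Finset.mem_singleton]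
      refine ⟨fun ho => hWlow o ho (hpos o), ?_⟩
      rintro rfl
      refine (hW o).2 fun p hp => mul_pos (hpos p) ?_
      exact sub_pos.2 (lt_of_le_of_ne (hlmax p (hpos p)) fun h => hp (hr h))
    simp [this]

section LCP

variable {ι : Type*} [Fintype ι] [DecidableEq ι]

/-- The complementary matrix of `N` for the active set `α`: the columns in `α` are those of `-N`,
the others are those of the identity. -/
def complMat (N : Matrix ι ι ℝ) (α : Finset ι) : Matrix ι ι ℝ :=
  Matrix.of fun i j => if j ∈ α then -N i j else (1 : Matrix ι ι ℝ) i j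

theorem complMat_mulVec (N : Matrix ι ι ℝ) (α : Finset ι) (x : ι → ℝ) :
    complMat N α *ᵥ x =
      (fun i => if i ∈ α then 0 else x i) - N *ᵥ fun j => if j ∈ α then x j else 0 := by
  have h : (fun i => if i ∈ α then 0 else x i) =
      (1 : Matrix ι ι ℝ) *ᵥ fun i => if i ∈ α then 0 else x i := by simp
  rw [h]
  ext i
  simp only [complMat, mulVec, dotProduct, Matrix.of_apply, Pi.sub_apply]
  rw [← Finset.sum_sub_distrib]
  refine Finset.sum_congr rfl fun j _ => ?_
  split_ifs <;> ring

/-- A non-negative vector in the complementary cone of `α` gives a solution of the LCP. -/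
theorem mem_lcpSol_of_complMat_mulVec {N : Matrix ι ι ℝ} {α : Finset ι} {x q : ι → ℝ}
    (hx : ∀ i, 0 ≤ x i) (h : complMat N α *ᵥ x = q) :
    (fun j => if j ∈ α then x j else 0) ∈ lcpSol N q := by
  have hy : N *ᵥ (fun j => if j ∈ α then x j else 0) + q =
      fun i => if i ∈ α then 0 else x i := by
    rw [← h, complMat_mulVec]; abel
  refine ⟨fun i => ?_, ?_, ?_⟩
  · dsimp; split_ifs
    exacts [hx i, le_rfl]
  · rw [hy]
    intro i
    dsimp; split_ifs
    exacts [le_rfl, hx i]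
  · rw [hy]
    refine Finset.sum_eq_zero fun i _ => ?_
    by_cases hi : i ∈ α <;> simp [hi]

/-- Complementary matrices of active sets which differ only at a zero entry of `x` agree on `x`. -/
theorem complMat_mulVec_congr {N : Matrix ι ι ℝ} {α β : Finset ι} {x : ι → ℝ} {i : ι}
    (hx : x i = 0) (h : ∀ j, j ≠ i → (j ∈ α ↔ j ∈ β)) :
    complMat N α *ᵥ x = complMat N β *ᵥ x := by
  ext k
  refine Finset.sum_congr rfl fun j _ => ?_
  by_cases hj : j = i
  · simp [hj, hx]
  · simp [complMat, h j hj]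

/-- Lemke's existence theorem for a copositive matrix and generic data, by counting
modulo two the endpoints of the segments in the union of all complementary cones
over the half-line `q + t d`, `t ≥ 0`. -/
theorem lcpSol_nonempty_of_generic (N : Matrix ι ι ℝ) (q d : ι → ℝ)
    (hN : ∀ z : ι → ℝ, 0 ≤ z → 0 ≤ z ⬝ᵥ (N *ᵥ z)) (hd : ∀ i, 0 < d i)
    (hdet : ∀ α, IsUnit (complMat N α).det)
    (hq : ∀ α i, ((complMat N α)⁻¹ *ᵥ q) i ≠ 0)
    (hb : ∀ α i, ((complMat N α)⁻¹ *ᵥ d) i ≠ 0)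
    (hqd : ∀ α i j, i ≠ j → ((complMat N α)⁻¹ *ᵥ q) i * ((complMat N α)⁻¹ *ᵥ d) j ≠
      ((complMat N α)⁻¹ *ᵥ q) j * ((complMat N α)⁻¹ *ᵥ d) i) :
    (lcpSol N q).Nonempty := by
  classical
  by_contra hempty
  set a : Finset ι → ι → ℝ := fun α => (complMat N α)⁻¹ *ᵥ q with ha
  set b : Finset ι → ι → ℝ := fun α => (complMat N α)⁻¹ *ᵥ d with hbdef
  have hmul : ∀ α (t : ℝ), complMat N α *ᵥ (a α + t • b α) = q + t • d := by
    intro α t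
    simp [ha, hbdef, mulVec_add, mulVec_smul, mulVec_mulVec, mul_nonsing_inv _ (hdet α)]
  have hinj : ∀ α (x : ι → ℝ) (t : ℝ), complMat N α *ᵥ x = q + t • d → x = a α + t • b α := by
    intro α x t h
    have : (complMat N α)⁻¹ *ᵥ (complMat N α *ᵥ x) = (complMat N α)⁻¹ *ᵥ (q + t • d) := by rw [h]
    simpa [mulVec_mulVec, nonsing_inv_mul _ (hdet α), mulVec_add, mulVec_smul, ha, hbdef] using this
  let β : Finset ι → Option ι → ℝ := fun α o => o.elim 1 (b α)
  let ρ : Finset ι → Option ι → ℝ := fun α o => o.elim 0 fun i => -a α i / b α i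
  let W : Finset ι → Option ι → Prop := fun α o => ∀ p, p ≠ o → 0 < β α p * (ρ α o - ρ α p)
  have hβρ : ∀ α i (t : ℝ), β α (some i) * (t - ρ α (some i)) = a α i + t * b α i := by
    intro α i t
    have : b α i ≠ 0 := hb α i
    simp only [β, ρ, Option.elim]
    field_simp
    ring
  have hslice : ∀ α, ((Finset.univ.filter (W α)).card : ZMod 2) = if α = ∅ then 1 else 0 := by
    intro α
    rw [card_filter_endpoints_mod_two (β α) (ρ α) ?_ ?_ ⟨none, by simp [β]⟩ (W α) fun _ => Iff.rfl]
    · by_cases hα : α = ∅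
      · subst hα
        have h1 : complMat N ∅ = 1 := by ext i j; simp [complMat]
        have h2 : b ∅ = d := by simp [hbdef, h1]
        rw [if_neg, if_pos rfl]
        push Not
        rintro (_ | i)
        · simp [β]
        · simpa [β, h2] using (hd i).le
      · rw [if_pos, if_neg hα]
        by_contra hcon
        push Not at hcon
        have hbpos : ∀ i, 0 ≤ b α i := fun i => hcon (some i)
        obtain ⟨i, hi⟩ := Finset.nonempty_iff_ne_empty.2 hα
        have hCb : complMat N α *ᵥ b α = d := by
          simp [hbdef, mulVec_mulVec, mul_nonsing_inv _ (hdet α)]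
        obtain ⟨h0, -, h2⟩ := mem_lcpSol_of_complMat_mulVec hbpos hCb
        have h3 := hN _ h0
        rw [dotProduct_add] at h2
        have h4 : 0 < (fun j => if j ∈ α then b α j else 0) ⬝ᵥ d := by
          refine Finset.sum_pos' (fun j _ => mul_nonneg (h0 j) (hd j).le) ⟨i, Finset.mem_univ _, ?_⟩
          simp only [hi, if_true]
          exact mul_pos (lt_of_le_of_ne (hbpos i) (hb α i).symm) (hd i)
        linarith
    · rintro (_ | i)
      · simp [β]
      · exact hb α i
    · rintro (_ | i) (_ | j) h
      · rfl
      · simp only [ρ, Option.elim] at h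
        rw [eq_comm, div_eq_zero_iff, neg_eq_zero] at h
        exact absurd h (not_or.2 ⟨hq α j, hb α j⟩)
      · simp only [ρ, Option.elim] at h
        rw [div_eq_zero_iff, neg_eq_zero] at h
        exact absurd h (not_or.2 ⟨hq α i, hb α i⟩)
      · by_contra hne
        simp only [ρ, Option.elim] at h
        rw [div_eq_div_iff (hb α i) (hb α j)] at h
        exact hqd α i j (fun h' => hne (by rw [h'])) (by linarith)
  have hnone : ∀ α, ¬ W α none := by
    intro α h
    apply hempty
    refine ⟨_, mem_lcpSol_of_complMat_mulVec (α := α) (x := a α) (fun i => ?_) ?_⟩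
    · have := h (some i) (by simp)
      simp only [show ρ α none = 0 from rfl] at this
      rw [hβρ] at this
      simpa using this.le
    · simpa using hmul α 0
  have hflip : ∀ α i, W α (some i) → W (symmDiff α {i}) (some i) := by
    intro α i h
    set t := ρ α (some i) with ht
    have hti : a α i + t * b α i = 0 := by rw [← hβρ, ht]; ring
    have hx : a α + t • b α = a (symmDiff α {i}) + t • b (symmDiff α {i}) := by
      apply hinj
      rw [← hmul α t]
      refine (complMat_mulVec_congr (i := i) (by simpa using hti) fun j hj => ?_).symm
      simp [Finset.mem_symmDiff, hj]
    have hx' : ∀ j, a α j + t * b α j = a (symmDiff α {i}) j + t * b (symmDiff α {i}) j :=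
      fun j => by simpa using congrFun hx j
    have ht' : ρ (symmDiff α {i}) (some i) = t := by
      have h1 := hx' i
      rw [hti] at h1
      have : b (symmDiff α {i}) i ≠ 0 := hb _ i
      simp only [ρ, Option.elim]
      rw [div_eq_iff this]
      linarith
    intro p hp
    rw [ht']
    rcases p with _ | j
    · exact h none hp
    · rw [hβρ, ← hx', ← hβρ]
      exact h (some j) hp
  have htotal : (∑ α : Finset ι, ∑ o : Option ι, if W α o then (1 : ZMod 2) else 0) = 1 := by
    calc _ = ∑ α : Finset ι, (if α = ∅ then (1 : ZMod 2) else 0) := by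
          refine Finset.sum_congr rfl fun α _ => ?_
          rw [← hslice α, Finset.sum_boole]
      _ = 1 := by simp
  have hzero : (∑ α : Finset ι, ∑ o : Option ι, if W α o then (1 : ZMod 2) else 0) = 0 := by
    rw [Finset.sum_comm]
    refine Finset.sum_eq_zero fun o _ => ?_
    rcases o with _ | i
    · simp [hnone]
    · refine Finset.sum_involution (fun α _ => symmDiff α {i}) ?_ ?_ ?_ ?_
      · intro α _
        have : W (symmDiff α {i}) (some i) ↔ W α (some i) :=
          ⟨fun h => by simpa using hflip _ _ h, hflip α i⟩
        simp only [this]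
        exact CharTwo.add_self_eq_zero _
      · intro α _ _ h
        have : symmDiff α {i} = α := h
        simp at this
      · simp
      · intro α _
        simp
  rw [hzero] at htotal
  exact zero_ne_one htotal

end LCP

section LCPExistence

variable {ι : Type*} [Fintype ι]

theorem tendsto_mulVec {τ : Type*} {l : Filter τ} {M : τ → Matrix ι ι ℝ}
    {z : τ → ι → ℝ} {M₀ : Matrix ι ι ℝ} {z₀ : ι → ℝ} (hM : Filter.Tendsto M l (nhds M₀))
    (hz : Filter.Tendsto z l (nhds z₀)) :
    Filter.Tendsto (fun i => M i *ᵥ z i) l (nhds (M₀ *ᵥ z₀)) :=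
  ((continuous_fst.matrix_mulVec continuous_snd).tendsto (M₀, z₀)).comp (hM.prodMk_nhds hz)

theorem tendsto_dotProduct {τ : Type*} {l : Filter τ} {y z : τ → ι → ℝ} {y₀ z₀ : ι → ℝ}
    (hy : Filter.Tendsto y l (nhds y₀)) (hz : Filter.Tendsto z l (nhds z₀)) :
    Filter.Tendsto (fun i => y i ⬝ᵥ z i) l (nhds (y₀ ⬝ᵥ z₀)) :=
  ((continuous_fst.dotProduct continuous_snd).tendsto (y₀, z₀)).comp (hy.prodMk_nhds hz)

theorem lcpSol_of_tendsto {τ : Type*} {l : Filter τ} [l.NeBot] {M : τ → Matrix ι ι ℝ}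
    {q z : τ → ι → ℝ} {M₀ : Matrix ι ι ℝ} {q₀ z₀ : ι → ℝ} (hM : Filter.Tendsto M l (nhds M₀))
    (hq : Filter.Tendsto q l (nhds q₀)) (hz : Filter.Tendsto z l (nhds z₀))
    (h : ∀ i, z i ∈ lcpSol (M i) (q i)) : z₀ ∈ lcpSol M₀ q₀ := by
  have hy := (tendsto_mulVec hM hz).add hq
  refine ⟨ge_of_tendsto' hz fun i => (h i).1, ge_of_tendsto' hy fun i => (h i).2.1, ?_⟩
  refine tendsto_nhds_unique (tendsto_dotProduct hz hy) ?_
  simp only [(h _).2.2]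
  exact tendsto_const_nhds

theorem smul_mem_lcpSol {M : Matrix ι ι ℝ} {q z : ι → ℝ} (h : z ∈ lcpSol M q) {t : ℝ}
    (ht : 0 ≤ t) : t • z ∈ lcpSol M (t • q) := by
  obtain ⟨h1, h2, h3⟩ := h
  have : M *ᵥ (t • z) + t • q = t • (M *ᵥ z + q) := by rw [mulVec_smul, smul_add]
  refine ⟨smul_nonneg ht h1, ?_, ?_⟩
  · rw [this]; exact smul_nonneg ht h2
  · rw [this, smul_dotProduct, dotProduct_smul, h3, smul_zero, smul_zero]

theorem exists_mem_forall_apply_ne_zero {κ : Type*} [Countable κ]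
    (ℓ : κ → (ι → ℝ) →ₗ[ℝ] ℝ) (hℓ : ∀ k, ℓ k ≠ 0) {U : Set (ι → ℝ)} (hU : IsOpen U)
    (hne : U.Nonempty) : ∃ x ∈ U, ∀ k, ℓ k x ≠ 0 := by
  by_contra hcon
  push Not at hcon
  have h0 : MeasureTheory.volume (⋃ k, ((ℓ k).ker : Set (ι → ℝ))) = 0 :=
    MeasureTheory.measure_iUnion_null fun k =>
      MeasureTheory.Measure.addHaar_submodule _ _ fun h => hℓ k (LinearMap.ker_eq_top.1 h)
  have hsub : U ⊆ ⋃ k, ((ℓ k).ker : Set (ι → ℝ)) := fun x hx => by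
    obtain ⟨k, hk⟩ := hcon x hx
    exact Set.mem_iUnion.2 ⟨k, hk⟩
  exact (hU.measure_pos MeasureTheory.volume hne).ne' (MeasureTheory.measure_mono_null hsub h0)

variable [DecidableEq ι]

/-- The linear functional `x ↦ v ⬝ᵥ C⁻¹ x`. -/
noncomputable def dotInv (C : Matrix ι ι ℝ) (v : ι → ℝ) : (ι → ℝ) →ₗ[ℝ] ℝ where
  toFun x := v ⬝ᵥ (C⁻¹ *ᵥ x)
  map_add' x y := by rw [mulVec_add, dotProduct_add]
  map_smul' t x := by rw [mulVec_smul, dotProduct_smul, RingHom.id_apply]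

theorem dotInv_ne_zero {C : Matrix ι ι ℝ} (hC : IsUnit C.det) {v : ι → ℝ} (hv : v ≠ 0) :
    dotInv C v ≠ 0 := by
  intro h
  have h1 : dotInv C v (C *ᵥ v) = 0 := by rw [h]; rfl
  have h2 : dotInv C v (C *ᵥ v) = v ⬝ᵥ v := by
    simp [dotInv, mulVec_mulVec, nonsing_inv_mul _ hC]
  rw [h2, dotProduct_self_eq_zero] at h1
  exact hv h1

theorem isUnit_det_complMat_add_smul_one (M : Matrix ι ι ℝ) (α : Finset ι) {ε : ℝ}
    (hε : -ε ∉ spectrum ℝ (Matrix.of fun i j => if i ∈ α ∧ j ∈ α then M i j else 0)) :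
    IsUnit (complMat (M + ε • 1) α).det := by
  rw [isUnit_iff_ne_zero]
  intro h0
  obtain ⟨v, hv, hCv⟩ := exists_mulVec_eq_zero_iff.2 h0
  rw [complMat_mulVec] at hCv
  set u : ι → ℝ := fun j => if j ∈ α then v j else 0 with hu
  have hrow : ∀ i, (if i ∈ α then 0 else v i) = (M *ᵥ u) i + ε * u i := by
    intro i
    have := congrFun hCv i
    simp only [add_mulVec, smul_mulVec, one_mulVec, Pi.sub_apply, Pi.add_apply, Pi.smul_apply,
      smul_eq_mul, Pi.zero_apply] at this
    linarith
  have hu0 : u ≠ 0 := by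
    intro h
    apply hv
    ext i
    by_cases hi : i ∈ α
    · simpa [hu, hi] using congrFun h i
    · simpa [h, hi] using hrow i
  apply hε
  rw [spectrum.mem_iff, isUnit_iff_isUnit_det, isUnit_iff_ne_zero, not_not]
  refine exists_mulVec_eq_zero_iff.1 ⟨u, hu0, ?_⟩
  ext i
  have hP : ((Matrix.of fun i j => if i ∈ α ∧ j ∈ α then M i j else 0) *ᵥ u) i =
      if i ∈ α then (M *ᵥ u) i else 0 := by
    by_cases hi : i ∈ α
    · simp only [hi, true_and, if_true, mulVec, dotProduct, Matrix.of_apply]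
      refine Finset.sum_congr rfl fun j _ => ?_
      by_cases hj : j ∈ α <;> simp [hj, hu]
    · simp [hi, mulVec, dotProduct]
  rw [sub_mulVec, Pi.sub_apply, hP, Algebra.algebraMap_eq_smul_one, smul_mulVec, one_mulVec]
  have := hrow i
  by_cases hi : i ∈ α
  · simp only [hi, if_true] at this ⊢
    simp only [Pi.smul_apply, smul_eq_mul, Pi.zero_apply]
    linarith
  · simp [hi, hu]

theorem exists_isUnit_det_complMat (M : Matrix ι ι ℝ) {δ : ℝ} (hδ : 0 < δ) :
    ∃ ε ∈ Set.Ioo 0 δ, ∀ α, IsUnit (complMat (M + ε • 1) α).det := by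
  have hfin : (⋃ α : Finset ι, Neg.neg ⁻¹' spectrum ℝ
      (Matrix.of fun i j => if i ∈ α ∧ j ∈ α then M i j else 0)).Finite :=
    Set.finite_iUnion fun α =>
      (Matrix.finite_spectrum _).preimage (neg_injective.injOn)
  obtain ⟨ε, hε, hε'⟩ := (Set.Ioo_infinite hδ).exists_notMem_finite hfin
  refine ⟨ε, hε, fun α => isUnit_det_complMat_add_smul_one M α fun h => hε' ?_⟩
  exact Set.mem_iUnion.2 ⟨α, h⟩

/-- Copositive linear complementarity problems are solvable after an arbitrarily small
perturbation. -/
theorem exists_perturbation_lcpSol_nonempty (M : Matrix ι ι ℝ)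
    (hM : ∀ z : ι → ℝ, 0 ≤ z → 0 ≤ z ⬝ᵥ (M *ᵥ z)) (q : ι → ℝ) {δ : ℝ} (hδ : 0 < δ) :
    ∃ ε ∈ Set.Ioo 0 δ, ∃ q' ∈ Metric.ball q δ, (lcpSol (M + ε • 1) q').Nonempty := by
  obtain ⟨ε, hε, hdet⟩ := exists_isUnit_det_complMat M hδ
  have hsingle : ∀ i : ι, (Pi.single i 1 : ι → ℝ) ≠ 0 := fun i => by simp
  obtain ⟨q', hq', hq'0⟩ := exists_mem_forall_apply_ne_zero
    (fun k : Finset ι × ι => dotInv (complMat (M + ε • 1) k.1) (Pi.single k.2 1))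
    (fun k => dotInv_ne_zero (hdet _) (hsingle _)) Metric.isOpen_ball ⟨q, Metric.mem_ball_self hδ⟩
  replace hq'0 : ∀ α i, ((complMat (M + ε • 1) α)⁻¹ *ᵥ q') i ≠ 0 := fun α i => by
    simpa [dotInv] using hq'0 (α, i)
  have hopen : IsOpen {d : ι → ℝ | ∀ i, 0 < d i} := by
    simp only [Set.ofPred_forall]
    exact isOpen_iInter_of_finite fun i => isOpen_lt continuous_const (continuous_apply i)
  let a : Finset ι → ι → ℝ := fun α => (complMat (M + ε • 1) α)⁻¹ *ᵥ q'
  let vec : Finset ι × (ι ⊕ {p : ι × ι // p.1 ≠ p.2}) → ι → ℝ := fun k =>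
    match k.2 with
    | Sum.inl i => Pi.single i 1
    | Sum.inr p => a k.1 p.1.1 • Pi.single p.1.2 1 - a k.1 p.1.2 • Pi.single p.1.1 1
  have hvec : ∀ k, vec k ≠ 0 := by
    rintro ⟨α, i | ⟨⟨i, j⟩, hij⟩⟩ h
    · exact hsingle i h
    · have := congrFun h j
      simp only [ne_eq] at hij
      simp [vec, Ne.symm hij] at this
      exact hq'0 α i this
  obtain ⟨d, hd, hd0⟩ := exists_mem_forall_apply_ne_zero
    (fun k => dotInv (complMat (M + ε • 1) k.1) (vec k))
    (fun k => dotInv_ne_zero (hdet _) (hvec k)) hopen ⟨fun _ => 1, fun _ => one_pos⟩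
  refine ⟨ε, hε, q', hq', lcpSol_nonempty_of_generic _ q' d ?_ hd hdet hq'0 ?_ ?_⟩
  · intro z hz
    rw [add_mulVec, dotProduct_add, smul_mulVec, one_mulVec, dotProduct_smul, smul_eq_mul]
    exact add_nonneg (hM z hz) (mul_nonneg hε.1.le (Finset.sum_nonneg fun i _ => mul_self_nonneg _))
  · intro α i
    simpa [dotInv, vec] using hd0 (α, Sum.inl i)
  · intro α i j hij h
    refine hd0 (α, Sum.inr ⟨(i, j), hij⟩) ?_
    simpa [dotInv, vec, sub_dotProduct, smul_dotProduct, a, sub_eq_zero] using h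

/-- A strictly copositive linear complementarity problem has a solution. -/
theorem lcpSol_nonempty_of_strictlyCopositive (M : Matrix ι ι ℝ) {κ : ℝ} (hκ : 0 < κ)
    (hM : ∀ z : ι → ℝ, 0 ≤ z → κ * (z ⬝ᵥ z) ≤ z ⬝ᵥ (M *ᵥ z)) (q : ι → ℝ) :
    (lcpSol M q).Nonempty := by
  have hself : ∀ z : ι → ℝ, 0 ≤ z ⬝ᵥ z := fun z => Finset.sum_nonneg fun i _ => mul_self_nonneg _
  have hcop : ∀ z : ι → ℝ, 0 ≤ z → 0 ≤ z ⬝ᵥ (M *ᵥ z) := fun z hz =>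
    (mul_nonneg hκ.le (hself z)).trans (hM z hz)
  choose ε hε q' hq' z hz using fun k : ℕ =>
    exists_perturbation_lcpSol_nonempty M hcop q (Nat.one_div_pos_of_nat (α := ℝ) (n := k))
  have hε0 : Filter.Tendsto ε Filter.atTop (nhds 0) :=
    squeeze_zero (fun k => (hε k).1.le) (fun k => (hε k).2.le) tendsto_one_div_add_atTop_nhds_zero_nat
  have hq0 : Filter.Tendsto q' Filter.atTop (nhds q) := by
    rw [tendsto_iff_dist_tendsto_zero]
    exact squeeze_zero (fun k => dist_nonneg) (fun k => (hq' k).le)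
      tendsto_one_div_add_atTop_nhds_zero_nat
  have hbound : ∀ k, ‖z k‖ ≤ Fintype.card ι * (‖q‖ + 1) / κ := by
    intro k
    obtain ⟨h1, -, h3⟩ := hz k
    rw [add_mulVec, smul_mulVec, one_mulVec, dotProduct_add, dotProduct_add, dotProduct_smul,
      smul_eq_mul] at h3
    have h4 : ‖q' k‖ ≤ ‖q‖ + 1 := by
      have h5 : dist (q' k) q ≤ 1 := (hq' k).le.trans (by
        rw [div_le_one (by positivity)]; linarith [k.cast_nonneg (α := ℝ)])
      rw [dist_eq_norm] at h5
      linarith [norm_le_norm_add_norm_sub' (q' k) q]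
    have h6 : -(z k ⬝ᵥ q' k) ≤ Fintype.card ι * (‖z k‖ * (‖q‖ + 1)) := by
      rw [dotProduct, ← Finset.sum_neg_distrib, ← nsmul_eq_mul]
      refine Finset.sum_le_card_nsmul _ _ _ fun i _ => ?_
      refine (neg_le_abs _).trans ?_
      rw [abs_mul]
      exact mul_le_mul (norm_le_pi_norm (z k) i) ((norm_le_pi_norm (q' k) i).trans h4)
        (abs_nonneg _) (norm_nonneg _)
    have h7 : ‖z k‖ * ‖z k‖ ≤ z k ⬝ᵥ z k := by
      have h8 : ‖z k‖ ≤ √(z k ⬝ᵥ z k) := by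
        refine (pi_norm_le_iff_of_nonneg (Real.sqrt_nonneg _)).2 fun i => ?_
        refine Real.abs_le_sqrt ?_
        rw [sq]
        exact Finset.single_le_sum (f := fun i => z k i * z k i)
          (fun i _ => mul_self_nonneg _) (Finset.mem_univ i)
      nlinarith [Real.mul_self_sqrt (hself (z k)), norm_nonneg (z k), Real.sqrt_nonneg (z k ⬝ᵥ z k)]
    have h9 := hM _ h1
    have h10 := mul_nonneg (hε k).1.le (hself (z k))
    have h11 : ‖z k‖ * (κ * ‖z k‖) ≤ ‖z k‖ * (Fintype.card ι * (‖q‖ + 1)) := by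
      nlinarith
    rw [le_div_iff₀ hκ]
    rcases (norm_nonneg (z k)).eq_or_lt with h | h
    · rw [← h, zero_mul]; positivity
    · linarith [le_of_mul_le_mul_left h11 h]
  obtain ⟨z₀, -, φ, hφ, hlim⟩ := tendsto_subseq_of_bounded
    (Metric.isBounded_closedBall (x := (0 : ι → ℝ)) (r := Fintype.card ι * (‖q‖ + 1) / κ))
    (x := z) fun k => mem_closedBall_zero_iff.2 (hbound k)
  refine ⟨z₀, lcpSol_of_tendsto (M := fun k => M + ε (φ k) • 1) ?_ (hq0.comp hφ.tendsto_atTop) hlim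
    fun k => hz (φ k)⟩
  simpa using ((hε0.comp hφ.tendsto_atTop).smul_const (1 : Matrix ι ι ℝ)).const_add M

end LCPExistence

section Contact

variable {n m : ℕ}

/-- The block matrix `[G, [0; E]; [μ, -Eᵀ], ε]`. -/
def contactMat (mu : Fin n → ℝ) (G : Matrix (ForceIdx n) (ForceIdx n) ℝ) (ε : ℝ) :
    Matrix (LCPIdx n) (LCPIdx n) ℝ :=
  Matrix.fromBlocks G (Matrix.fromRows 0 (frictionE n))
    (Matrix.fromCols (Matrix.diagonal mu) (-(frictionE n)ᵀ)) (ε • 1)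

theorem frictionE_mulVec (s : Fin n → ℝ) (p : Fin n × Fin 2) :
    (frictionE n *ᵥ s) p = s p.1 := by
  simp [frictionE, mulVec, dotProduct]

theorem frictionE_transpose_mulVec (x : Fin n × Fin 2 → ℝ) (j : Fin n) :
    ((frictionE n)ᵀ *ᵥ x) j = x (j, 0) + x (j, 1) := by
  simp [frictionE, mulVec, dotProduct, Fintype.sum_prod_type, Fin.sum_univ_two,
    Finset.sum_add_distrib]

theorem contactMat_mulVec (mu : Fin n → ℝ) (G : Matrix (ForceIdx n) (ForceIdx n) ℝ) (ε : ℝ)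
    (f : ForceIdx n → ℝ) (s : Fin n → ℝ) :
    contactMat mu G ε *ᵥ Sum.elim f s =
      Sum.elim (G *ᵥ f + Sum.elim (0 : Fin n → ℝ) fun p => s p.1)
        fun j => mu j * f (Sum.inl j) - (f (Sum.inr (j, 0)) + f (Sum.inr (j, 1))) + ε * s j := by
  rw [contactMat, fromBlocks_mulVec]
  ext ((j | p) | j)
  · simp [fromRows_mulVec]
  · simp [fromRows_mulVec, frictionE_mulVec]
  · simp [fromCols_mulVec, neg_mulVec, frictionE_transpose_mulVec, mulVec_diagonal, smul_mulVec]
    ring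

theorem mem_lcpSol_iff {ι : Type*} [Fintype ι] {M : Matrix ι ι ℝ} {w z : ι → ℝ} :
    z ∈ lcpSol M w ↔ ∀ i, 0 ≤ z i ∧ 0 ≤ (M *ᵥ z + w) i ∧ z i * (M *ᵥ z + w) i = 0 := by
  constructor
  · rintro ⟨h1, h2, h3⟩ i
    exact ⟨h1 i, h2 i,
      (Finset.sum_eq_zero_iff_of_nonneg fun i _ => mul_nonneg (h1 i) (h2 i)).1 h3 i
        (Finset.mem_univ i)⟩
  · intro h
    exact ⟨fun i => (h i).1, fun i => (h i).2.1, Finset.sum_eq_zero fun i _ => (h i).2.2⟩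

theorem sumElim_mem_lcpSol_contactMat_iff {mu : Fin n → ℝ}
    {G : Matrix (ForceIdx n) (ForceIdx n) ℝ} {ε : ℝ} {f u : ForceIdx n → ℝ} {s : Fin n → ℝ} :
    Sum.elim f s ∈ lcpSol (contactMat mu G ε) (Sum.elim u 0) ↔
      ∀ j, (0 ≤ f (Sum.inl j) ∧ 0 ≤ (G *ᵥ f + u) (Sum.inl j) ∧
          f (Sum.inl j) * (G *ᵥ f + u) (Sum.inl j) = 0) ∧
        (∀ k, 0 ≤ f (Sum.inr (j, k)) ∧ 0 ≤ (G *ᵥ f + u) (Sum.inr (j, k)) + s j ∧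
          f (Sum.inr (j, k)) * ((G *ᵥ f + u) (Sum.inr (j, k)) + s j) = 0) ∧
        0 ≤ s j ∧
        0 ≤ mu j * f (Sum.inl j) - (f (Sum.inr (j, 0)) + f (Sum.inr (j, 1))) + ε * s j ∧
        s j * (mu j * f (Sum.inl j) - (f (Sum.inr (j, 0)) + f (Sum.inr (j, 1))) + ε * s j) = 0 := by
  rw [mem_lcpSol_iff, contactMat_mulVec]
  simp only [Sum.forall, Prod.forall, Pi.add_apply, Sum.elim_inl, Sum.elim_inr, Pi.zero_apply,
    add_zero, forall_and]
  simp only [add_right_comm _ (s _)]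
  tauto

/-- The slack variable at each contact is zero or the negative of a tangential velocity. -/
def SlackTight (G : Matrix (ForceIdx n) (ForceIdx n) ℝ) (u f : ForceIdx n → ℝ) (s : Fin n → ℝ) :
    Prop :=
  ∀ j, s j = 0 ∨ ∃ k, s j = -(G *ᵥ f + u) (Sum.inr (j, k))

theorem slackTight_of_mem_lcpSol {mu : Fin n → ℝ} (hmu : ∀ j, 0 ≤ mu j)
    {G : Matrix (ForceIdx n) (ForceIdx n) ℝ} {ε : ℝ} (hε : 0 < ε) {f u : ForceIdx n → ℝ}
    {s : Fin n → ℝ} (h : Sum.elim f s ∈ lcpSol (contactMat mu G ε) (Sum.elim u 0)) :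
    SlackTight G u f s := by
  rw [sumElim_mem_lcpSol_contactMat_iff] at h
  intro j
  obtain ⟨⟨hn, -, -⟩, ht, hs, -, hs0⟩ := h j
  by_cases hf : ∃ k, f (Sum.inr (j, k)) ≠ 0
  · obtain ⟨k, hk⟩ := hf
    exact Or.inr ⟨k, eq_neg_of_add_eq_zero_right ((mul_eq_zero.1 (ht k).2.2).resolve_left hk)⟩
  · push Not at hf
    left
    rw [hf, hf] at hs0
    rcases mul_eq_zero.1 hs0 with h | h
    · exact h
    · nlinarith [mul_nonneg (hmu j) hn, mul_nonneg hε.le hs]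

theorem exists_slackTight {mu : Fin n → ℝ}
    {G : Matrix (ForceIdx n) (ForceIdx n) ℝ} {f u : ForceIdx n → ℝ}
    {s : Fin n → ℝ} (h : Sum.elim f s ∈ lcpSol (contactMat mu G 0) (Sum.elim u 0)) :
    ∃ s', Sum.elim f s' ∈ lcpSol (contactMat mu G 0) (Sum.elim u 0) ∧ SlackTight G u f s' := by
  rw [sumElim_mem_lcpSol_contactMat_iff] at h
  suffices H : ∀ j, ∃ x, ((∀ k, 0 ≤ f (Sum.inr (j, k)) ∧
        0 ≤ (G *ᵥ f + u) (Sum.inr (j, k)) + x ∧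
        f (Sum.inr (j, k)) * ((G *ᵥ f + u) (Sum.inr (j, k)) + x) = 0) ∧ 0 ≤ x ∧
        0 ≤ mu j * f (Sum.inl j) - (f (Sum.inr (j, 0)) + f (Sum.inr (j, 1))) + 0 * x ∧
        x * (mu j * f (Sum.inl j) - (f (Sum.inr (j, 0)) + f (Sum.inr (j, 1))) + 0 * x) = 0) ∧
        (x = 0 ∨ ∃ k, x = -(G *ᵥ f + u) (Sum.inr (j, k))) by
    choose s' hs' ht' using H
    exact ⟨s', sumElim_mem_lcpSol_contactMat_iff.2 fun j => ⟨(h j).1, hs' j⟩, ht'⟩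
  intro j
  obtain ⟨⟨hn, -, -⟩, ht, hs, hc, hs0⟩ := h j
  by_cases hf : ∃ k, f (Sum.inr (j, k)) ≠ 0
  · obtain ⟨k, hk⟩ := hf
    exact ⟨s j, ⟨ht, hs, hc, hs0⟩,
      Or.inr ⟨k, eq_neg_of_add_eq_zero_right ((mul_eq_zero.1 (ht k).2.2).resolve_left hk)⟩⟩
  · push Not at hf
    set a : Fin 2 → ℝ := fun k => (G *ᵥ f + u) (Sum.inr (j, k)) with ha
    obtain ⟨x, hx0, hxa, hxs, hx⟩ : ∃ x, 0 ≤ x ∧ (∀ k, 0 ≤ a k + x) ∧ x ≤ s j ∧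
        (x = 0 ∨ ∃ k, x = -a k) := by
      refine ⟨max 0 (max (-a 0) (-a 1)), le_max_left _ _, ?_, ?_, ?_⟩
      · have h0 := (le_max_left (-a 0) (-a 1)).trans (le_max_right 0 _)
        have h1 := (le_max_right (-a 0) (-a 1)).trans (le_max_right 0 _)
        intro k
        fin_cases k
        · simp only [Fin.zero_eta]; linarith
        · simp only [Fin.mk_one]; linarith
      · have h0 := (ht 0).2.1
        have h1 := (ht 1).2.1
        exact max_le hs (max_le (by simp only [ha]; linarith) (by simp only [ha]; linarith))
      · rcases max_choice 0 (max (-a 0) (-a 1)) with h | h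
        · exact Or.inl h
        · rw [h]
          rcases max_choice (-a 0) (-a 1) with h' | h'
          · exact Or.inr ⟨0, h'⟩
          · exact Or.inr ⟨1, h'⟩
    refine ⟨x, ⟨fun k => ⟨(ht k).1, hxa k, by rw [hf, zero_mul]⟩, hx0, by simpa using hc, ?_⟩, hx⟩
    rcases mul_eq_zero.1 hs0 with h | h
    · rw [le_antisymm (hxs.trans h.le) hx0, zero_mul]
    · rw [zero_mul] at h ⊢
      rw [h, mul_zero]

theorem norm_le_of_slackTight {G : Matrix (ForceIdx n) (ForceIdx n) ℝ} {u f : ForceIdx n → ℝ}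
    {s : Fin n → ℝ} (h : SlackTight G u f s) : ‖s‖ ≤ ‖G *ᵥ f + u‖ := by
  refine (pi_norm_le_iff_of_nonneg (norm_nonneg _)).2 fun j => ?_
  rcases h j with h | ⟨k, h⟩
  · rw [h, norm_zero]; exact norm_nonneg _
  · rw [h, norm_neg]; exact norm_le_pi_norm _ _

attribute [local instance] Matrix.linftyOpNormedAddCommGroup in
theorem exists_norm_mulVec_add_le {ι : Type*} [Fintype ι] {G : ℕ → Matrix ι ι ℝ}
    {G₀ : Matrix ι ι ℝ} (hG : Filter.Tendsto G Filter.atTop (nhds G₀)) (u : ι → ℝ) :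
    ∃ K, 0 ≤ K ∧ ∀ i f, ‖G i *ᵥ f + u‖ ≤ K * (1 + ‖f‖) := by
  obtain ⟨K, hK⟩ := hG.norm.bddAbove_range
  have hK' : ∀ i, ‖G i‖ ≤ K := fun i => hK ⟨i, rfl⟩
  have hK0 : 0 ≤ K := (norm_nonneg _).trans (hK' 0)
  refine ⟨K + ‖u‖, by positivity, fun i f => ?_⟩
  calc ‖G i *ᵥ f + u‖ ≤ ‖G i‖ * ‖f‖ + ‖u‖ :=
        (norm_add_le _ _).trans (add_le_add_left (Matrix.linfty_opNorm_mulVec _ _) _)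
    _ ≤ K * ‖f‖ + ‖u‖ := by gcongr; exact hK' i
    _ ≤ (K + ‖u‖) * (1 + ‖f‖) := by
        nlinarith [mul_nonneg (norm_nonneg u) (norm_nonneg f)]

namespace ContactModel

variable (S : ContactModel n m)

theorem perfectMat_eq : S.perfectMat = contactMat S.mu (S.JO * S.A * S.JOᵀ) 0 := by
  simp [perfectMat, contactMat]

theorem finiteMat_eq (X : Matrix (Fin m) (Fin m) ℝ) :
    S.finiteMat X = contactMat S.mu (S.JO * S.A * S.JOᵀ + S.JM * X * S.JMᵀ) 0 := by
  simp [finiteMat, contactMat]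

theorem continuous_contactMat (mu : Fin n → ℝ) :
    Continuous fun p : Matrix (ForceIdx n) (ForceIdx n) ℝ × ℝ => contactMat mu p.1 p.2 :=
  continuous_fst.matrix_fromBlocks continuous_const continuous_const
    (continuous_snd.smul continuous_const)

/-- If zero is the only internal force, then tight solutions of the models with matrices
converging to the one of perfect velocity control have a subsequence along which the contact
forces converge to a force of the perfect velocity control model. -/
theorem exists_subseq_tendsto_forceSet (hF0 : S.forceSet 0 = {0}) (v : Fin m → ℝ)
    {G : ℕ → Matrix (ForceIdx n) (ForceIdx n) ℝ} {ε : ℕ → ℝ}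
    (hG : Filter.Tendsto G Filter.atTop (nhds (S.JO * S.A * S.JOᵀ)))
    (hε : Filter.Tendsto ε Filter.atTop (nhds 0))
    {f : ℕ → ForceIdx n → ℝ} {s : ℕ → Fin n → ℝ}
    (h : ∀ i, Sum.elim (f i) (s i) ∈ lcpSol (contactMat S.mu (G i) (ε i)) (S.lcpVec v))
    (hs : ∀ i, SlackTight (G i) (S.JM *ᵥ v) (f i) (s i)) :
    ∃ g ∈ S.forceSet v, ∃ φ : ℕ → ℕ, StrictMono φ ∧
      Filter.Tendsto (f ∘ φ) Filter.atTop (nhds g) := by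
  obtain ⟨K, hK0, hK⟩ := exists_norm_mulVec_add_le hG (S.JM *ᵥ v)
  set t : ℕ → ℝ := fun i => (1 + ‖f i‖)⁻¹ with ht
  have htpos : ∀ i, 0 < t i := fun i => by positivity
  have ht1 : ∀ i, t i + ‖t i • f i‖ = 1 := fun i => by
    rw [norm_smul, Real.norm_of_nonneg (htpos i).le, ht]
    field_simp
  have hts : ∀ i, ‖t i • s i‖ ≤ K := fun i => by
    rw [norm_smul, Real.norm_of_nonneg (htpos i).le, ht, inv_mul_le_iff₀ (by positivity), mul_comm]
    exact (norm_le_of_slackTight (hs i)).trans (hK i _)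
  let x : ℕ → ℝ × (ForceIdx n → ℝ) × (Fin n → ℝ) := fun i => (t i, t i • f i, t i • s i)
  have hx : ∀ i, x i ∈ Metric.closedBall 0 (max 1 K) := by
    intro i
    rw [mem_closedBall_zero_iff]
    refine norm_prod_le_iff.2 ⟨?_, norm_prod_le_iff.2 ⟨?_, (hts i).trans (le_max_right _ _)⟩⟩
    · refine le_trans ?_ (le_max_left _ _)
      rw [Real.norm_of_nonneg (htpos i).le]
      linarith [ht1 i, norm_nonneg (t i • f i)]
    · refine le_trans ?_ (le_max_left _ _)
      change ‖t i • f i‖ ≤ 1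
      linarith [ht1 i, htpos i]
  obtain ⟨⟨t₀, f₀, s₀⟩, -, φ, hφ, hlim⟩ :=
    tendsto_subseq_of_bounded Metric.isBounded_closedBall hx
  have hlt : Filter.Tendsto (fun i => t (φ i)) Filter.atTop (nhds t₀) := hlim.fst_nhds
  have hlf : Filter.Tendsto (fun i => t (φ i) • f (φ i)) Filter.atTop (nhds f₀) :=
    hlim.snd_nhds.fst_nhds
  have hls : Filter.Tendsto (fun i => t (φ i) • s (φ i)) Filter.atTop (nhds s₀) :=
    hlim.snd_nhds.snd_nhds
  have hsum : t₀ + ‖f₀‖ = 1 :=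
    tendsto_nhds_unique (hlt.add hlf.norm) (by simp only [ht1]; exact tendsto_const_nhds)
  have hsol : Sum.elim f₀ s₀ ∈ lcpSol S.perfectMat (t₀ • S.lcpVec v) := by
    refine lcpSol_of_tendsto (l := Filter.atTop)
      (M := fun i => contactMat S.mu (G (φ i)) (ε (φ i)))
      (z := fun i => t (φ i) • Sum.elim (f (φ i)) (s (φ i))) ?_ (hlt.smul_const _) ?_
      fun i => smul_mem_lcpSol (h (φ i)) (htpos (φ i)).le
    · rw [perfectMat_eq]
      exact ((continuous_contactMat S.mu).tendsto (_, _)).comp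
        ((hG.comp hφ.tendsto_atTop).prodMk_nhds (hε.comp hφ.tendsto_atTop))
    · rw [tendsto_pi_nhds]
      rintro (p | j)
      · exact (tendsto_pi_nhds.1 hlf) p
      · exact (tendsto_pi_nhds.1 hls) j
  have ht₀ : 0 < t₀ := by
    refine lt_of_le_of_ne (ge_of_tendsto' hlt fun i => (htpos _).le) fun h0 => ?_
    have hf₀ : f₀ ∈ S.forceSet 0 := by
      refine ⟨s₀, ?_⟩
      have hw : S.lcpVec 0 = t₀ • S.lcpVec v := by
        rw [← h0, zero_smul]
        ext (p | j) <;> simp [lcpVec]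
      rwa [hw]
    rw [hF0, Set.mem_singleton_iff] at hf₀
    simp [hf₀, ← h0] at hsum
  refine ⟨t₀⁻¹ • f₀, ⟨t₀⁻¹ • s₀, ?_⟩, φ, hφ, ?_⟩
  · have := smul_mem_lcpSol hsol (inv_nonneg.2 ht₀.le)
    rw [smul_smul, inv_mul_cancel₀ ht₀.ne', one_smul] at this
    convert this using 1
    ext (p | j) <;> simp
  · refine ((hlt.inv₀ ht₀.ne').smul hlf).congr fun i => ?_
    simp [smul_smul, inv_mul_cancel₀ (htpos (φ i)).ne']

theorem perfectMat_copositive (hmu : ∀ j, 0 ≤ S.mu j) (hA : S.A.PosDef) {z : LCPIdx n → ℝ}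
    (hz : 0 ≤ z) : 0 ≤ z ⬝ᵥ (S.perfectMat *ᵥ z) := by
  obtain ⟨f, s, rfl⟩ : ∃ f s, z = Sum.elim f s :=
    ⟨z ∘ Sum.inl, z ∘ Sum.inr, (Sum.elim_comp_inl_inr z).symm⟩
  have hquad : 0 ≤ f ⬝ᵥ ((S.JO * S.A * S.JOᵀ) *ᵥ f) := by
    have := (hA.posSemidef.mul_mul_conjTranspose_same S.JO).dotProduct_mulVec_nonneg f
    simpa using this
  have hfric : 0 ≤ ∑ j, s j * (S.mu j * f (Sum.inl j)) := Finset.sum_nonneg fun j _ =>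
    mul_nonneg (hz (Sum.inr j)) (mul_nonneg (hmu j) (hz (Sum.inl (Sum.inl j))))
  rw [perfectMat_eq, contactMat_mulVec, sumElim_dotProduct_sumElim, dotProduct_add]
  have h1 : f ⬝ᵥ (Sum.elim (0 : Fin n → ℝ) fun p => s p.1) =
      ∑ j, s j * (f (Sum.inr (j, 0)) + f (Sum.inr (j, 1))) := by
    simp [dotProduct, Fintype.sum_sum_type, Fintype.sum_prod_type, Fin.sum_univ_two]
    exact Finset.sum_congr rfl fun j _ => by ring
  have h2 : (s ⬝ᵥ fun j => S.mu j * f (Sum.inl j) - (f (Sum.inr (j, 0)) + f (Sum.inr (j, 1))) +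
      0 * s j) = ∑ j, s j * (S.mu j * f (Sum.inl j)) -
        ∑ j, s j * (f (Sum.inr (j, 0)) + f (Sum.inr (j, 1))) := by
    rw [← Finset.sum_sub_distrib]
    exact Finset.sum_congr rfl fun j _ => by ring
  rw [h1, h2]
  linarith

theorem forceSet_nonempty (hmu : ∀ j, 0 ≤ S.mu j) (hA : S.A.PosDef) (hF0 : S.forceSet 0 = {0})
    (v : Fin m → ℝ) : (S.forceSet v).Nonempty := by
  have hpert : ∀ ε : ℝ, S.perfectMat + ε • 1 =
      contactMat S.mu (S.JO * S.A * S.JOᵀ + ε • 1) ε := by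
    intro ε
    rw [perfectMat_eq, contactMat, contactMat, ← fromBlocks_one, fromBlocks_smul, fromBlocks_add]
    simp
  have hex : ∀ k : ℕ, ∃ f s, Sum.elim f s ∈
      lcpSol (S.perfectMat + (1 / ((k : ℝ) + 1)) • 1) (S.lcpVec v) := by
    intro k
    have hε : 0 < 1 / ((k : ℝ) + 1) := Nat.one_div_pos_of_nat
    obtain ⟨z, hz⟩ := lcpSol_nonempty_of_strictlyCopositive
      (S.perfectMat + (1 / ((k : ℝ) + 1)) • 1) hε (fun z hz => by
        rw [add_mulVec, smul_mulVec, one_mulVec, dotProduct_add, dotProduct_smul, smul_eq_mul]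
        linarith [S.perfectMat_copositive hmu hA hz]) (S.lcpVec v)
    exact ⟨z ∘ Sum.inl, z ∘ Sum.inr, by rwa [Sum.elim_comp_inl_inr]⟩
  choose f s hfs using hex
  simp only [hpert] at hfs
  have hε := tendsto_one_div_add_atTop_nhds_zero_nat (𝕜 := ℝ)
  have hG := (hε.smul_const (1 : Matrix (ForceIdx n) (ForceIdx n) ℝ)).const_add
    (S.JO * S.A * S.JOᵀ)
  rw [zero_smul, add_zero] at hG
  obtain ⟨g, hg, -⟩ := S.exists_subseq_tendsto_forceSet hF0 v hG hε hfs
    fun k => slackTight_of_mem_lcpSol hmu Nat.one_div_pos_of_nat (hfs k)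
  exact ⟨g, hg⟩

theorem convergesToSet_forceSet (hF0 : S.forceSet 0 = {0})
    {v : Fin m → ℝ} {X : ℕ → Matrix (Fin m) (Fin m) ℝ}
    (hX : Filter.Tendsto X Filter.atTop (nhds 0)) {f : ℕ → ForceIdx n → ℝ} {s : ℕ → Fin n → ℝ}
    (h : ∀ i, Sum.elim (f i) (s i) ∈ lcpSol (S.finiteMat (X i)) (S.lcpVec v)) :
    ConvergesToSet f (S.forceSet v) := by
  intro ε hε
  by_contra hcon
  rw [Filter.not_eventually] at hcon
  obtain ⟨φ, hφ, hfar⟩ := Filter.extraction_of_frequently_atTop hcon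
  simp only [finiteMat_eq] at h
  choose s' hs' htight using fun i => exists_slackTight (h i)
  have hG : Filter.Tendsto (fun i => S.JO * S.A * S.JOᵀ + S.JM * X i * S.JMᵀ) Filter.atTop
      (nhds (S.JO * S.A * S.JOᵀ)) := by
    have hc : Continuous fun Y : Matrix (Fin m) (Fin m) ℝ =>
        S.JO * S.A * S.JOᵀ + S.JM * Y * S.JMᵀ := by fun_prop
    simpa [Function.comp_def] using (hc.tendsto 0).comp hX
  obtain ⟨g, hg, ψ, -, hlim⟩ := S.exists_subseq_tendsto_forceSet hF0 v
    (hG.comp hφ.tendsto_atTop) tendsto_const_nhds (fun i => hs' (φ i)) fun i => htight (φ i)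
  have hnorm : Filter.Tendsto (fun i => ‖WithLp.toLp 2 (f (φ (ψ i)) - g)‖) Filter.atTop
      (nhds 0) := by
    have hc : Continuous fun y : ForceIdx n → ℝ => ‖WithLp.toLp 2 (y - g)‖ :=
      ((PiLp.continuous_toLp 2 _).comp (continuous_id.sub continuous_const)).norm
    simpa [Function.comp_def] using (hc.tendsto g).comp hlim
  obtain ⟨i, hi⟩ := (hnorm.eventually_lt_const hε).exists
  exact hfar (ψ i) ⟨g, hg, hi⟩

end ContactModel

end Contact

theorem theorem4 {n m : ℕ} (S : ContactModel n m)
    (hmu : ∀ j, 0 ≤ S.mu j) (hA : S.A.PosDef)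
    (B : Matrix (Fin m) (Fin m) ℝ) (hB : B.PosDef)
    (vd : Fin m → ℝ)
    (hF0 : S.forceSet 0 = {0}) :
    (S.forceSet vd).Nonempty ∧
      ∀ (c : ℕ → ℝ) (f : ℕ → ForceIdx n → ℝ) (s : ℕ → Fin n → ℝ),
        Filter.Tendsto c Filter.atTop (nhds 0) →
        (∀ i, Sum.elim (f i) (s i) ∈ lcpSol (S.finiteMat (c i • B)) (S.lcpVec vd)) →
        ConvergesToSet f (S.forceSet vd) :=
  ⟨S.forceSet_nonempty hmu hA hF0 vd, fun c _ _ hc h =>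
    S.convergesToSet_forceSet hF0 (X := fun i => c i • B)
      (by simpa using hc.smul_const B) h⟩
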